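/- **Definitions.** A *doctrine* is a functor $P:\mathcal C^{\mathrm{op}}\to\mathbf{Pos}$, where $\mathcal C$ has finite products; $P(A)$ is the fiber over $A$, and $\mathbf t$ denotes the terminal object. $P$ is *Boolean* if every fiber is a Heyting algebra, all operations $\wedge,\top,\to,\vee,\bot$ are preserved by reindexing, and $\neg=(-)\to\bot$ is in each fiber an isomorphism $P(A)^{\mathrm{op}}\cong P(A)$. $P$ is *existential* if all reindexings $P(\mathrm{pr}_1):P(A)\to P(A\times B)$ along first projections have left adjoints $\exists^B_A$ satisfying the Beck–Chevalley condition $\exists^B_A P(f\times \mathrm{id}_B)=P(f)\exists^B_{A'}$ for all $f:A\to A'$ and Frobenius reciprocity $\exists^B_A(\alpha\wedge P(\mathrm{pr}_1)\beta)=\exists^B_A\alpha\wedge\beta$. A doctrine $R$ is *consistent* if there are $a,b\in R(\mathbf t)$ with $a\not\leq b$. **Construction.** Let $P$ be an existential doctrine with small base category $\mathcal C$ whose fibers are cartesian closed meet-semilattices, with $\wedge,\top,\to$ preserved by reindexing. Let $\Lambda$ be the cardinality of $\bigsqcup_{A}P(A)$, regarded as the set of ordinals below it. (1) Let $J$ be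 the directed preorder, under inclusion of sets of entries, of finite lists $\bar X=((X_1,x_1),\dots,(X_n,x_n))$ of distinct pairs with $X_i\in\mathrm{ob}\,\mathcal C$ and $x_i\in\Lambda$; write $\Pi\bar X=X_1\times\dots\times X_n$. Let $\underline P:\underline{\mathcal C}^{\mathrm{op}}\to\mathbf{Pos}$ be the directed colimit, over $\bar X\in J$, of the doctrines obtained from $P$ by adding a constant of sort $\Pi\bar X$: $\underline{\mathcal C}$ has the objects of $\mathcal C$; an arrow $A\to B$ is a class $[f,\bar X]$ with $f:\Pi\bar X\times A\to B$ in $\mathcal C$; an element of $\underline P(A)$ is a class $[\alpha,\bar X]$ with $\alpha\in P(\Pi\bar X\times A)$; two representatives are identified (and elements are compared) when this is so after reindexing along the projections from a common larger list. (2) For every object $B$ choose a listing $\big([\varphi^B_j,\bar X^{(B,j)}]\big)_{j\in\Lambda}$ of all elements of $\underline P(B)$, with chosen representatives $\varphi^B_j\in P(\Pi\bar X^{(B,j)}\times B)$. Let $d^B_j$ be the smallest ordinal greater than all $d^B_h$ with $h<j$ and than all second entries of the lists $\bar X^{(B,k)}$ with $k\leq j$. Call the choice *admissible* if $d^B_j\in\Lambda$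 for all $B$ and $j$. Put $\psi^B_j=P(\mathrm{pr}_1)\exists^B_{\Pi\bar X^{(B,j)}}\varphi^B_j\to\varphi^B_j\in P(\Pi\bar X^{(B,j)}\times B)$. The *Henkin axiom* of $(B,j)$ is its class $h^B_j\in\underline P(\mathbf t)$ with respect to the list $\bar X^{(B,j)}$ extended by $(B,d^B_j)$. (3) For a finite set $\mathcal U\subseteq \mathrm{ob}\,\mathcal C\times\Lambda$ let $\underline P^{\,\mathcal U}(A)=\{\alpha\in\underline P(A): \alpha\leq\underline P(!_A)\bigwedge_{(B,j)\in\mathcal U}h^B_j\}$, where $!_A:A\to\mathbf t$; for $\mathcal U\subseteq\mathcal V$ map $\alpha\in\underline P^{\,\mathcal U}(A)$ to $\alpha\wedge\underline P(!_A)\bigwedge_{(B,j)\in\mathcal V}h^B_j$. Let $\underrightarrow P:\underline{\mathcal C}^{\mathrm{op}}\to\mathbf{Pos}$ be the directed colimit of the doctrines $\underline P^{\,\mathcal U}$ over all finite $\mathcal U$ ordered by inclusion. **Proposition.** Let $P:\mathcal C^{\mathrm{op}}\to\mathbf{Pos}$ be a Boolean existential doctrine with small base category $\mathcal C$ such that every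 fiber has at least two elements. Then admissible choices exist, and for every admissible choice the doctrine $\underrightarrow P$ is consistent. -/

import Mathlib

open CategoryTheory CategoryTheory.Limits Opposite

universe u v w

set_option linter.unusedSectionVars false

noncomputable section

/-! ## Doctrines -/

/-- A doctrine: a contravariant functor to posets on a category with finite products. -/
abbrev Doctrine (C : Type u) [Category.{v} C] [HasFiniteProducts C] : Type _ :=
  Cᵒᵖ ⥤ PartOrd.{w}

namespace Doctrine

variable {C : Type u} [Category.{v} C] [HasFiniteProducts C]

/-- The fiber of a doctrine over an object. -/
abbrev Fib (P : Doctrine.{u, v, w} C) (A : C) : Type w := P.obj (op A)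

/-- The reindexing along an arrow. -/
def re (P : Doctrine.{u, v, w} C) {A B : C} (f : A ⟶ B) : P.Fib B →o P.Fib A :=
  (P.map f.op).hom

theorem re_id (P : Doctrine.{u, v, w} C) {A : C} (a : P.Fib A) : P.re (𝟙 A) a = a := by
  simp [re]

theorem re_comp (P : Doctrine.{u, v, w} C) {A B D : C} (f : A ⟶ B) (g : B ⟶ D) (a : P.Fib D) :
    P.re (f ≫ g) a = P.re f (P.re g a) := by
  simp [re]

/-- Consistency: over the terminal object there are `a`, `b` with `a ≰ b`. -/
def IsConsistent (P : Doctrine.{u, v, w} C) : Prop :=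
  ∃ a b : P.Fib (⊤_ C), ¬ a ≤ b

/-- Every fiber has at least two elements. -/
def HasNontrivialFibers (P : Doctrine.{u, v, w} C) : Prop :=
  ∀ A : C, Nontrivial (P.Fib A)

end Doctrine

section Structure

variable {C : Type u} [Category.{v} C] [HasFiniteProducts C]

/-- Finite meets in each fiber, preserved by reindexing. -/
class PrimaryDoctrine (P : Doctrine.{u, v, w} C) where
  inf : ∀ {A : C}, P.Fib A → P.Fib A → P.Fib A
  top : ∀ A : C, P.Fib A
  isGLB_inf : ∀ {A : C} (a b : P.Fib A), IsGLB {a, b} (inf a b)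
  isTop_top : ∀ A : C, IsTop (top A)
  re_inf : ∀ {A B : C} (f : A ⟶ B) (a b : P.Fib B),
    P.re f (inf a b) = inf (P.re f a) (P.re f b)
  re_top : ∀ {A B : C} (f : A ⟶ B), P.re f (top B) = top A

/-- Each fiber is cartesian closed, naturally in the object. -/
class ImplicationalDoctrine (P : Doctrine.{u, v, w} C) extends PrimaryDoctrine P where
  imp : ∀ {A : C}, P.Fib A → P.Fib A → P.Fib A
  le_imp_iff : ∀ {A : C} (a b c : P.Fib A), a ≤ imp b c ↔ inf a b ≤ c
  re_imp : ∀ {A B : C} (f : A ⟶ B) (a b : P.Fib B),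
    P.re f (imp a b) = imp (P.re f a) (P.re f b)

/-- Each fiber is a Heyting algebra, naturally in the object. -/
class HeytingDoctrine (P : Doctrine.{u, v, w} C) extends ImplicationalDoctrine P where
  sup : ∀ {A : C}, P.Fib A → P.Fib A → P.Fib A
  bot : ∀ A : C, P.Fib A
  isLUB_sup : ∀ {A : C} (a b : P.Fib A), IsLUB {a, b} (sup a b)
  isBot_bot : ∀ A : C, IsBot (bot A)
  re_sup : ∀ {A B : C} (f : A ⟶ B) (a b : P.Fib B),
    P.re f (sup a b) = sup (P.re f a) (P.re f b)
  re_bot : ∀ {A B : C} (f : A ⟶ B), P.re f (bot B) = bot A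

/-- A Heyting doctrine whose negation `a ↦ (a → ⊥)` is, in each fiber, an isomorphism from the
opposite poset (its naturality is automatic). -/
class BooleanDoctrine (P : Doctrine.{u, v, w} C) extends HeytingDoctrine P where
  neg_iso : ∀ A : C, ∃ e : (P.Fib A)ᵒᵈ ≃o P.Fib A,
    ∀ a : P.Fib A, e (OrderDual.toDual a) = imp a (bot A)

/-- Left adjoints to reindexing along first projections `A ⨯ B ⟶ A`, with the Beck-Chevalley
condition and Frobenius reciprocity. -/
class ExistentialDoctrine (P : Doctrine.{u, v, w} C) [PrimaryDoctrine P] where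
  ex : ∀ {A B : C}, P.Fib (A ⨯ B) → P.Fib A
  gc : ∀ A B : C,
    GaloisConnection (ex (A := A) (B := B)) (P.re (prod.fst : A ⨯ B ⟶ A))
  beckChevalley : ∀ {A A' B : C} (f : A ⟶ A') (a : P.Fib (A' ⨯ B)),
    ex (P.re (prod.map f (𝟙 B)) a) = P.re f (ex a)
  frobenius : ∀ {A B : C} (a : P.Fib (A ⨯ B)) (b : P.Fib A),
    ex (PrimaryDoctrine.inf a (P.re prod.fst b)) = PrimaryDoctrine.inf (ex a) b

end Structure

/-! ## Directed colimits of posets -/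

/-- The directed colimit of a directed system of posets and monotone maps: the quotient of the
disjoint union identifying elements that become equal at some later stage. -/
def PosetColim {ι : Type*} [Preorder ι] [IsDirectedOrder ι] {F : ι → Type*}
    [∀ i, PartialOrder (F i)] (f : ∀ i j, i ≤ j → F i →o F j)
    [DirectedSystem F (f · · ·)] : Type _ :=
  DirectLimit F f

namespace PosetColim

variable {ι : Type*} [Preorder ι] [IsDirectedOrder ι] {F : ι → Type*}
  [∀ i, PartialOrder (F i)] (f : ∀ i j, i ≤ j → F i →o F j)
  [DirectedSystem F (f · · ·)]

/-- The class of an element of the stage `i`. -/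
def mk (i : ι) (x : F i) : PosetColim f := (⟦⟨i, x⟩⟧ : DirectLimit F f)

theorem mk_eq_mk {i j : ι} {x : F i} {y : F j} :
    mk f i x = mk f j y ↔ ∃ (k : ι) (hi : i ≤ k) (hj : j ≤ k), f i k hi x = f j k hj y :=
  Quotient.eq

theorem mk_map {i j : ι} (h : i ≤ j) (x : F i) : mk f j (f i j h x) = mk f i x :=
  DirectLimit.mk_apply (f := f) i j x h

theorem ind {p : PosetColim f → Prop} (h : ∀ i x, p (mk f i x)) (z : PosetColim f) : p z :=
  DirectLimit.induction f h z

theorem ind₂ {p : PosetColim f → PosetColim f → Prop}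
    (h : ∀ i x y, p (mk f i x) (mk f i y)) (z t : PosetColim f) : p z t :=
  DirectLimit.induction₂ f h z t

theorem ind₃ {p : PosetColim f → PosetColim f → PosetColim f → Prop}
    (h : ∀ i x y z, p (mk f i x) (mk f i y) (mk f i z)) (z t s : PosetColim f) : p z t s :=
  DirectLimit.induction₃ f h z t s

/-- `[x] ≤ [y]` when this holds at some common stage. -/
instance : LE (PosetColim f) where
  le z t := ∃ (i : ι) (x y : F i), z = mk f i x ∧ t = mk f i y ∧ x ≤ y

theorem mk_le_mk {i : ι} {x y : F i} :
    mk f i x ≤ mk f i y ↔ ∃ (k : ι) (h : i ≤ k), f i k h x ≤ f i k h y := by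
  constructor
  · rintro ⟨j, x', y', hx, hy, hle⟩
    obtain ⟨k₁, h₁, h₁', e₁⟩ := (mk_eq_mk f).1 hx
    obtain ⟨k₂, h₂, h₂', e₂⟩ := (mk_eq_mk f).1 hy
    obtain ⟨k, hk₁, hk₂⟩ := exists_ge_ge k₁ k₂
    refine ⟨k, h₁.trans hk₁, ?_⟩
    have e₁' : f i k (h₁.trans hk₁) x = f j k (h₁'.trans hk₁) x' := by
      rw [← DirectedSystem.map_map' f h₁ hk₁, e₁, DirectedSystem.map_map']
    have e₂' : f i k (h₂.trans hk₂) y = f j k (h₂'.trans hk₂) y' := by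
      rw [← DirectedSystem.map_map' f h₂ hk₂, e₂, DirectedSystem.map_map']
    rw [e₁', e₂']
    exact (f j k _).monotone hle
  · rintro ⟨k, h, hle⟩
    exact ⟨k, _, _, (mk_map f h x).symm, (mk_map f h y).symm, hle⟩

theorem mk_mono {i : ι} {x y : F i} (h : x ≤ y) : mk f i x ≤ mk f i y :=
  ⟨i, x, y, rfl, rfl, h⟩

instance : PartialOrder (PosetColim f) where
  le_refl z := by
    induction z using ind with
    | h i x => exact mk_mono f le_rfl
  le_trans a b c := by
    induction a, b, c using ind₃ with
    | h i x y z =>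
      rw [mk_le_mk, mk_le_mk, mk_le_mk]
      rintro ⟨j, hj, h₁⟩ ⟨k, hk, h₂⟩
      obtain ⟨m, hjm, hkm⟩ := exists_ge_ge j k
      refine ⟨m, hj.trans hjm, ?_⟩
      have h₁' := (f j m hjm).monotone h₁
      have h₂' := (f k m hkm).monotone h₂
      rw [DirectedSystem.map_map', DirectedSystem.map_map'] at h₁' h₂'
      exact h₁'.trans h₂'
  le_antisymm a b := by
    induction a, b using ind₂ with
    | h i x y =>
      rw [mk_le_mk, mk_le_mk]
      rintro ⟨j, hj, h₁⟩ ⟨k, hk, h₂⟩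
      obtain ⟨m, hjm, hkm⟩ := exists_ge_ge j k
      have h₁' := (f j m hjm).monotone h₁
      have h₂' := (f k m hkm).monotone h₂
      rw [DirectedSystem.map_map', DirectedSystem.map_map'] at h₁' h₂'
      exact (mk_eq_mk f).2 ⟨m, hj.trans hjm, hj.trans hjm, le_antisymm h₁' h₂'⟩

/-- A compatible family of functions on the stages induces a function on the colimit. -/
def lift {D : Type*} (g : ∀ i, F i → D) (hg : ∀ i j h x, g i x = g j (f i j h x)) :
    PosetColim f → D :=
  DirectLimit.lift f g hg

@[simp] theorem lift_mk {D : Type*} (g : ∀ i, F i → D)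
    (hg : ∀ i j h x, g i x = g j (f i j h x)) (i : ι) (x : F i) :
    lift f g hg (mk f i x) = g i x := rfl

/-- A compatible family of binary operations induces a binary operation. -/
def map₂ (g : ∀ i, F i → F i → F i)
    (hg : ∀ i j h x y, f i j h (g i x y) = g j (f i j h x) (f i j h y)) :
    PosetColim f → PosetColim f → PosetColim f :=
  DirectLimit.map₂ f f f g hg

@[simp] theorem map₂_mk (g : ∀ i, F i → F i → F i)
    (hg : ∀ i j h x y, f i j h (g i x y) = g j (f i j h x) (f i j h y)) (i : ι) (x y : F i) :
    map₂ f g hg (mk f i x) (mk f i y) = mk f i (g i x y) :=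
  DirectLimit.map₂_def f f f g hg i x y

end PosetColim

/-! ## Adding constants: the directed preorder of lists and the base category -/

section Constants

variable (C : Type u) [Category.{v} C] [HasFiniteProducts C] (L : Type*)

/-- Finite lists without repetitions of labelled sorts `(X, x)`; the entry `(X, x)` is a new
constant of sort `X`. -/
def ConstList : Type _ := {l : List (C × L) // l.Nodup}

namespace ConstList

variable {C L}

instance : Preorder (ConstList C L) where
  le X Y := X.1 ⊆ Y.1
  le_refl X := List.Subset.refl X.1
  le_trans _ _ _ := List.Subset.trans

instance : IsDirectedOrder (ConstList C L) where
  directed X Y := by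
    classical
    exact ⟨⟨(X.1 ++ Y.1).dedup, List.nodup_dedup _⟩,
      fun p hp => List.mem_dedup.2 (List.mem_append_left _ hp),
      fun p hp => List.mem_dedup.2 (List.mem_append_right _ hp)⟩

/-- The empty list. -/
def nil : ConstList C L := ⟨[], List.nodup_nil⟩

theorem nil_le (X : ConstList C L) : nil ≤ X := List.nil_subset X.1

instance : Nonempty (ConstList C L) := ⟨nil⟩

instance (X : ConstList C L) : Finite {p // p ∈ X.1} := X.1.finite_toSet

/-- The product of the sorts in the list; as the entries of the list are distinct, its positions
are indexed by its members. -/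
def dom (X : ConstList C L) : C := ∏ᶜ fun p : {p // p ∈ X.1} => p.1.1

/-- The projection onto a component. -/
def π (X : ConstList C L) (p : {p // p ∈ X.1}) : X.dom ⟶ p.1.1 :=
  Pi.π (fun p : {p // p ∈ X.1} => p.1.1) p

/-- The tuple with given components. -/
def lift (X : ConstList C L) {A : C} (k : ∀ p : {p // p ∈ X.1}, A ⟶ p.1.1) : A ⟶ X.dom :=
  Pi.lift k

@[simp] theorem lift_π (X : ConstList C L) {A : C} (k : ∀ p : {p // p ∈ X.1}, A ⟶ p.1.1)
    (p : {p // p ∈ X.1}) : X.lift k ≫ X.π p = k p :=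
  Limits.Pi.lift_π _ _

theorem hom_ext (X : ConstList C L) {A : C} (g h : A ⟶ X.dom)
    (e : ∀ p, g ≫ X.π p = h ≫ X.π p) : g = h :=
  Pi.hom_ext _ _ e

/-- The projection on the components of a smaller list. -/
def proj {X Y : ConstList C L} (h : X ≤ Y) : Y.dom ⟶ X.dom :=
  X.lift fun p => Y.π ⟨p.1, h p.2⟩

@[simp] theorem proj_π {X Y : ConstList C L} (h : X ≤ Y) (p : {p // p ∈ X.1}) :
    proj h ≫ X.π p = Y.π ⟨p.1, h p.2⟩ := by
  simp [proj]

theorem proj_refl (X : ConstList C L) : proj (le_refl X) = 𝟙 X.dom :=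
  X.hom_ext _ _ fun p => by simp

theorem proj_trans {X Y Z : ConstList C L} (h : X ≤ Y) (k : Y ≤ Z) :
    proj k ≫ proj h = proj (h.trans k) :=
  X.hom_ext _ _ fun p => by simp

/-- The projection above, times the identity of `A`. -/
def projTimes {X Y : ConstList C L} (h : X ≤ Y) (A : C) : Y.dom ⨯ A ⟶ X.dom ⨯ A :=
  prod.map (proj h) (𝟙 A)

theorem projTimes_refl (X : ConstList C L) (A : C) : projTimes (le_refl X) A = 𝟙 _ := by
  simp [projTimes, proj_refl]

theorem projTimes_trans {X Y Z : ConstList C L} (h : X ≤ Y) (k : Y ≤ Z) (A : C) :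
    projTimes k A ≫ projTimes h A = projTimes (h.trans k) A := by
  simp [projTimes, proj_trans]

@[simp] theorem projTimes_fst {X Y : ConstList C L} (h : X ≤ Y) (A : C) :
    projTimes h A ≫ prod.fst = prod.fst ≫ proj h := by simp [projTimes]

@[simp] theorem projTimes_snd {X Y : ConstList C L} (h : X ≤ Y) (A : C) :
    projTimes h A ≫ prod.snd = prod.snd := by simp [projTimes]

/-- A list containing the entries of two given lists. -/
def join (X Y : ConstList C L) : ConstList C L :=
  (exists_ge_ge X Y).choose

theorem le_join_left (X Y : ConstList C L) : X ≤ X.join Y := (exists_ge_ge X Y).choose_spec.1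

theorem le_join_right (X Y : ConstList C L) : Y ≤ X.join Y := (exists_ge_ge X Y).choose_spec.2

/-- For `f : ∏ X ⨯ A ⟶ B` and `X ≤ Z ≥ Y`, the arrow `∏ Z ⨯ A ⟶ ∏ Y ⨯ B` with components the
projection and `f`. -/
def act {X Y Z : ConstList C L} (hX : X ≤ Z) (hY : Y ≤ Z) {A B : C} (f : X.dom ⨯ A ⟶ B) :
    Z.dom ⨯ A ⟶ Y.dom ⨯ B :=
  prod.lift (prod.fst ≫ proj hY) (projTimes hX A ≫ f)

@[simp] theorem act_fst {X Y Z : ConstList C L} (hX : X ≤ Z) (hY : Y ≤ Z) {A B : C}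
    (f : X.dom ⨯ A ⟶ B) : act hX hY f ≫ prod.fst = prod.fst ≫ proj hY :=
  Limits.prod.lift_fst _ _

@[simp] theorem act_snd {X Y Z : ConstList C L} (hX : X ≤ Z) (hY : Y ≤ Z) {A B : C}
    (f : X.dom ⨯ A ⟶ B) : act hX hY f ≫ prod.snd = projTimes hX A ≫ f :=
  Limits.prod.lift_snd _ _

theorem prod_hom_ext {A B D : C} {f g : D ⟶ A ⨯ B} (h₁ : f ≫ prod.fst = g ≫ prod.fst)
    (h₂ : f ≫ prod.snd = g ≫ prod.snd) : f = g :=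
  Limits.prod.hom_ext h₁ h₂

theorem projTimes_act {X Y Z W : ConstList C L} (hX : X ≤ Z) (hY : Y ≤ Z) (k : Z ≤ W) {A B : C}
    (f : X.dom ⨯ A ⟶ B) :
    projTimes k A ≫ act hX hY f = act (hX.trans k) (hY.trans k) f := by
  apply prod_hom_ext
  · rw [Category.assoc, act_fst, act_fst, ← Category.assoc, projTimes_fst, Category.assoc,
      proj_trans]
  · rw [Category.assoc, act_snd, act_snd, ← Category.assoc, projTimes_trans]

theorem act_projTimes {X Y Y' Z : ConstList C L} (hX : X ≤ Z) (hY' : Y' ≤ Z) (h : Y ≤ Y')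
    {A B : C} (f : X.dom ⨯ A ⟶ B) :
    act hX hY' f ≫ projTimes h B = act hX (h.trans hY') f := by
  apply prod_hom_ext
  · rw [Category.assoc, projTimes_fst, act_fst, ← Category.assoc, act_fst, Category.assoc,
      proj_trans]
  · rw [Category.assoc, projTimes_snd, act_snd, act_snd]

theorem act_congr {X X' Y Z : ConstList C L} (hX : X ≤ Z) (hX' : X' ≤ Z) (hY : Y ≤ Z)
    {A B : C} {f : X.dom ⨯ A ⟶ B} {f' : X'.dom ⨯ A ⟶ B}
    (e : projTimes hX A ≫ f = projTimes hX' A ≫ f') : act hX hY f = act hX' hY f' := by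
  simp only [act, e]

theorem act_comp {X Y V Z : ConstList C L} (hX : X ≤ Z) (hY : Y ≤ Z) (hV : V ≤ Z)
    {A B D : C} (f : X.dom ⨯ A ⟶ B) (g : Y.dom ⨯ B ⟶ D) :
    act (le_refl Z) hV (act hX hY f ≫ g) = act hX (le_refl Z) f ≫ act hY hV g := by
  apply prod_hom_ext
  · rw [Category.assoc, act_fst, act_fst, ← Category.assoc, act_fst, proj_refl, Category.comp_id]
  · rw [Category.assoc, act_snd, act_snd, ← Category.assoc, ← Category.assoc, projTimes_act,
      act_projTimes]

theorem act_id {X Z : ConstList C L} (hX : X ≤ Z) (A : C) :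
    act (nil_le Z) hX (prod.snd : (nil : ConstList C L).dom ⨯ A ⟶ A) = projTimes hX A := by
  apply prod_hom_ext <;> simp

end ConstList

/-- The base category with the new constants: it has the objects of `C`. -/
structure ConstCat (C : Type u) (L : Type*) where
  of : C

namespace ConstCat

open ConstList

variable {C L}

/-- Arrows `A ⇢ B` are arrows `∏ X ⨯ A ⟶ B` for some list `X`, two of them being identified when
they agree after projecting from a larger list. -/
def homSetoid (A B : C) : Setoid (Σ X : ConstList C L, (X.dom ⨯ A ⟶ B)) where
  r f g := ∃ (Z : ConstList C L) (hf : f.1 ≤ Z) (hg : g.1 ≤ Z),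
    projTimes hf A ≫ f.2 = projTimes hg A ≫ g.2
  iseqv := by
    refine ⟨fun f => ⟨f.1, le_rfl, le_rfl, rfl⟩,
      fun ⟨Z, hf, hg, e⟩ => ⟨Z, hg, hf, e.symm⟩, ?_⟩
    rintro f g h ⟨Z, hf, hg, e⟩ ⟨Z', hg', hh, e'⟩
    obtain ⟨W, k, k'⟩ := exists_ge_ge Z Z'
    refine ⟨W, hf.trans k, hh.trans k', ?_⟩
    rw [← projTimes_trans hf k, Category.assoc, e, ← Category.assoc, projTimes_trans,
      ← projTimes_trans hh k', Category.assoc, ← e', ← Category.assoc, projTimes_trans]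

instance : Quiver (ConstCat C L) where
  Hom A B := Quotient (homSetoid (L := L) A.of B.of)

/-- The class of an arrow `∏ X ⨯ A ⟶ B`. -/
def homMk {A B : ConstCat C L} (X : ConstList C L) (f : X.dom ⨯ A.of ⟶ B.of) : A ⟶ B :=
  (⟦⟨X, f⟩⟧ : Quotient (homSetoid (L := L) A.of B.of))

theorem homMk_eq {A B : ConstCat C L} {X Y : ConstList C L} {f : X.dom ⨯ A.of ⟶ B.of}
    {g : Y.dom ⨯ A.of ⟶ B.of} :
    homMk X f = homMk Y g ↔ ∃ (Z : ConstList C L) (hX : X ≤ Z) (hY : Y ≤ Z),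
      projTimes hX A.of ≫ f = projTimes hY A.of ≫ g :=
  Quotient.eq

theorem homMk_projTimes {A B : ConstCat C L} {X Y : ConstList C L} (h : X ≤ Y)
    (f : X.dom ⨯ A.of ⟶ B.of) : homMk Y (projTimes h A.of ≫ f) = homMk X f :=
  homMk_eq.2 ⟨Y, le_rfl, h, by rw [projTimes_refl, Category.id_comp]⟩

theorem hom_ind {A B : ConstCat C L} {p : (A ⟶ B) → Prop} (h : ∀ X f, p (homMk X f))
    (f : A ⟶ B) : p f :=
  Quotient.ind (fun f => h f.1 f.2) f

theorem comp_aux {A B D : C} {X X' Y Y' Z Z' : ConstList C L}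
    (hX : X ≤ Z) (hY : Y ≤ Z) (hX' : X' ≤ Z') (hY' : Y' ≤ Z')
    {f : X.dom ⨯ A ⟶ B} {f' : X'.dom ⨯ A ⟶ B} {g : Y.dom ⨯ B ⟶ D} {g' : Y'.dom ⨯ B ⟶ D}
    (ef : (homSetoid A B).r ⟨X, f⟩ ⟨X', f'⟩) (eg : (homSetoid B D).r ⟨Y, g⟩ ⟨Y', g'⟩) :
    (homSetoid A D).r ⟨Z, act hX hY f ≫ g⟩ ⟨Z', act hX' hY' f' ≫ g'⟩ := by
  obtain ⟨U, hU, hU', e⟩ := ef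
  obtain ⟨V, hV, hV', e'⟩ := eg
  dsimp only at hU hU' hV hV' e e'
  obtain ⟨S, hS, hS'⟩ := exists_ge_ge U V
  obtain ⟨T, hT, hT'⟩ := exists_ge_ge Z Z'
  obtain ⟨W, hW, hW'⟩ := exists_ge_ge S T
  refine ⟨W, hT.trans hW', hT'.trans hW', ?_⟩
  dsimp only
  rw [← Category.assoc, ← Category.assoc, projTimes_act, projTimes_act]
  have h₁ : act (hX.trans (hT.trans hW')) (hY.trans (hT.trans hW')) f =
      act (hX'.trans (hT'.trans hW')) (hY.trans (hT.trans hW')) f' := by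
    apply act_congr
    have := congrArg (fun t => projTimes (hS.trans hW) A ≫ t) e
    simpa only [← Category.assoc, projTimes_trans] using this
  rw [h₁, ← act_projTimes _ (hS'.trans hW) hV, ← act_projTimes _ (hS'.trans hW) hV',
    Category.assoc, Category.assoc, e']

instance : CategoryStruct (ConstCat C L) where
  id _ := homMk nil prod.snd
  comp {A B D} f g := Quotient.map₂
    (sa := homSetoid A.of B.of) (sb := homSetoid B.of D.of) (sc := homSetoid A.of D.of)
    (fun f g => ⟨f.1.join g.1, act (le_join_left _ _) (le_join_right _ _) f.2 ≫ g.2⟩)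
    (fun _ _ ef _ _ eg => comp_aux _ _ _ _ ef eg) f g

/-- Composition is computed in any common list. -/
theorem comp_mk {A B D : ConstCat C L} {X Y Z : ConstList C L} (hX : X ≤ Z) (hY : Y ≤ Z)
    (f : X.dom ⨯ A.of ⟶ B.of) (g : Y.dom ⨯ B.of ⟶ D.of) :
    (homMk X f : A ⟶ B) ≫ (homMk Y g : B ⟶ D) = homMk Z (act hX hY f ≫ g) :=
  Quotient.sound (comp_aux _ _ hX hY ((homSetoid A.of B.of).refl _) ((homSetoid B.of D.of).refl _))

instance : Category (ConstCat C L) where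
  id_comp {A B} f := by
    induction f using hom_ind with
    | h X f =>
      refine (comp_mk (nil_le X) (le_refl X) _ _).trans ?_
      rw [act_id, projTimes_refl, Category.id_comp]
  comp_id {A B} f := by
    induction f using hom_ind with
    | h X f =>
      refine (comp_mk (le_refl X) (nil_le X) _ _).trans ?_
      rw [act_snd, projTimes_refl, Category.id_comp]
  assoc {A B D E} f g h := by
    induction f using hom_ind with
    | h X f =>
    induction g using hom_ind with
    | h Y g =>
    induction h using hom_ind with
    | h V h =>
      obtain ⟨T, hX, hY⟩ := exists_ge_ge X Y
      obtain ⟨Z, hT, hV⟩ := exists_ge_ge T V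
      rw [comp_mk (hX.trans hT) (hY.trans hT), comp_mk (le_refl Z) hV, comp_mk (hY.trans hT) hV,
        comp_mk (hX.trans hT) (le_refl Z), act_comp, Category.assoc]

/-- The image of an arrow of `C`. -/
def incl {A B : C} (f : A ⟶ B) : (⟨A⟩ : ConstCat C L) ⟶ ⟨B⟩ :=
  homMk (A := ⟨A⟩) (B := ⟨B⟩) nil (prod.snd ≫ f)

theorem comp_incl {A : ConstCat C L} {B D : C} {X : ConstList C L} (f : X.dom ⨯ A.of ⟶ B)
    (g : B ⟶ D) : (homMk X f : A ⟶ ⟨B⟩) ≫ incl g = homMk (B := ⟨D⟩) X (f ≫ g) := by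
  refine (comp_mk (le_refl X) (nil_le X) _ _).trans ?_
  rw [← Category.assoc, act_snd, projTimes_refl, Category.id_comp]

/-- The terminal object of `C` is terminal. -/
def isTerminal : IsTerminal (⟨⊤_ C⟩ : ConstCat C L) :=
  IsTerminal.ofUniqueHom (fun A => homMk nil (terminal.from _)) fun A m => by
    induction m using hom_ind with
    | h X f => exact homMk_eq.2 ⟨X, le_rfl, nil_le X, Subsingleton.elim _ _⟩

instance : HasTerminal (ConstCat C L) := isTerminal.hasTerminal

/-- The binary products of `C` are binary products. -/
theorem hasLimit_pair (A B : ConstCat C L) : HasLimit (pair A B) := by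
  refine ⟨⟨⟨BinaryFan.mk (P := (⟨A.of ⨯ B.of⟩ : ConstCat C L)) (incl prod.fst) (incl prod.snd),
    ?_⟩⟩⟩
  have ex : ∀ {T : ConstCat C L} (f : T ⟶ A) (g : T ⟶ B),
      ∃ h : T ⟶ ⟨A.of ⨯ B.of⟩, h ≫ incl prod.fst = f ∧ h ≫ incl prod.snd = g := by
    intro T f g
    induction f using hom_ind with
    | h X f =>
    induction g using hom_ind with
    | h Y g =>
      obtain ⟨Z, hX, hY⟩ := exists_ge_ge X Y
      refine ⟨homMk (B := ⟨A.of ⨯ B.of⟩) Z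
        (prod.lift (projTimes hX _ ≫ f) (projTimes hY _ ≫ g)), ?_, ?_⟩
      · rw [comp_incl, prod.lift_fst]; exact homMk_projTimes hX f
      · rw [comp_incl, prod.lift_snd]; exact homMk_projTimes hY g
  have uniq : ∀ {T : ConstCat C L} (h k : T ⟶ ⟨A.of ⨯ B.of⟩),
      h ≫ incl prod.fst = k ≫ incl prod.fst → h ≫ incl prod.snd = k ≫ incl prod.snd →
      h = k := by
    intro T h k
    induction h using hom_ind with
    | h X h =>
    induction k using hom_ind with
    | h Y k =>
      rw [comp_incl, comp_incl, comp_incl, comp_incl]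
      intro e₁ e₂
      obtain ⟨U, hU, hU', e₁⟩ := homMk_eq.1 e₁
      obtain ⟨V, hV, hV', e₂⟩ := homMk_eq.1 e₂
      obtain ⟨W, hW, hW'⟩ := exists_ge_ge U V
      refine homMk_eq.2 ⟨W, hU.trans hW, hU'.trans hW, prod_hom_ext ?_ ?_⟩
      · have := congrArg (fun t => projTimes hW _ ≫ t) e₁
        simpa only [← Category.assoc, projTimes_trans] using this
      · have := congrArg (fun t => projTimes hW' _ ≫ t) e₂
        simpa only [← Category.assoc, projTimes_trans] using this
  exact BinaryFan.isLimitMk (fun s => (ex s.fst s.snd).choose)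
    (fun s => (ex s.fst s.snd).choose_spec.1) (fun s => (ex s.fst s.snd).choose_spec.2)
    (fun s m h₁ h₂ => uniq _ _ (h₁.trans (ex s.fst s.snd).choose_spec.1.symm)
      (h₂.trans (ex s.fst s.snd).choose_spec.2.symm))

instance : HasFiniteProducts (ConstCat C L) := by
  have : HasBinaryProducts (ConstCat C L) :=
    have : ∀ A B : ConstCat C L, HasLimit (pair A B) := hasLimit_pair
    hasBinaryProducts_of_hasLimit_pair _
  exact hasFiniteProducts_of_has_binary_and_terminal

end ConstCat

end Constants

/-! ## The doctrine with the new constants -/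

section AddConstants

open ConstList ConstCat

variable {C : Type u} [Category.{v} C] [HasFiniteProducts C]
variable (P : Doctrine.{u, v, w} C) (L : Type*)

/-- The fibers `P (∏ X ⨯ A)`, with transition maps the reindexings along the projections. -/
def constSys (A : C) (X Y : ConstList C L) (h : X ≤ Y) :
    P.Fib (X.dom ⨯ A) →o P.Fib (Y.dom ⨯ A) :=
  P.re (projTimes h A)

instance (A : C) : DirectedSystem (fun X : ConstList C L => (P.Fib (X.dom ⨯ A) : Type w))
    (constSys P L A · · ·) where
  map_self X a := by
    change P.re (projTimes (le_refl X) A) a = a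
    rw [projTimes_refl, P.re_id]
  map_map _ _ _ h k a := by
    change P.re (projTimes k A) (P.re (projTimes h A) a) = P.re (projTimes (h.trans k) A) a
    rw [← P.re_comp, projTimes_trans]

/-- The fiber over `A` of the doctrine with the new constants. -/
abbrev ConstFib (A : C) : Type _ :=
  PosetColim (F := fun X : ConstList C L => (P.Fib (X.dom ⨯ A) : Type w)) (constSys P L A)

variable {L}

/-- The class of an element of `P (∏ X ⨯ A)`. -/
def fibMk {A : C} (X : ConstList C L) (a : P.Fib (X.dom ⨯ A)) : ConstFib P L A :=
  PosetColim.mk (constSys P L A) X a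

theorem fibMk_eq {A : C} {X Y : ConstList C L} {a : P.Fib (X.dom ⨯ A)}
    {b : P.Fib (Y.dom ⨯ A)} :
    fibMk P X a = fibMk P Y b ↔ ∃ (Z : ConstList C L) (hX : X ≤ Z) (hY : Y ≤ Z),
      P.re (projTimes hX A) a = P.re (projTimes hY A) b :=
  PosetColim.mk_eq_mk _

theorem fibMk_re {A : C} {X Y : ConstList C L} (h : X ≤ Y) (a : P.Fib (X.dom ⨯ A)) :
    fibMk P Y (P.re (projTimes h A) a) = fibMk P X a :=
  PosetColim.mk_map (constSys P L A) h a

theorem fibMk_le {A : C} {X : ConstList C L} {a b : P.Fib (X.dom ⨯ A)} :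
    fibMk P X a ≤ fibMk P X b ↔
      ∃ (Z : ConstList C L) (h : X ≤ Z), P.re (projTimes h A) a ≤ P.re (projTimes h A) b :=
  PosetColim.mk_le_mk _

theorem fib_ind {A : C} {p : ConstFib P L A → Prop} (h : ∀ X a, p (fibMk P X a))
    (z : ConstFib P L A) : p z :=
  PosetColim.ind _ h z

theorem fib_ind₂ {A : C} {p : ConstFib P L A → ConstFib P L A → Prop}
    (h : ∀ X a b, p (fibMk P X a) (fibMk P X b)) (z t : ConstFib P L A) : p z t :=
  PosetColim.ind₂ _ h z t

theorem reAux_compat {A B : C} {X Y Y' Z Z' : ConstList C L} (hX : X ≤ Z) (hY : Y ≤ Z)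
    (hX' : X ≤ Z') (hY' : Y' ≤ Z') (h : Y ≤ Y') (f : X.dom ⨯ A ⟶ B) (b : P.Fib (Y.dom ⨯ B)) :
    fibMk P Z (P.re (act hX hY f) b) =
      fibMk P Z' (P.re (act hX' hY' f) (P.re (projTimes h B) b)) := by
  obtain ⟨W, k, k'⟩ := exists_ge_ge Z Z'
  refine (fibMk_eq P).2 ⟨W, k, k', ?_⟩
  rw [← P.re_comp, ← P.re_comp, ← P.re_comp, projTimes_act, Category.assoc, act_projTimes,
    projTimes_act]

/-- Reindexing along a representative. -/
def reAux {A B : C} (X : ConstList C L) (f : X.dom ⨯ A ⟶ B) :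
    ConstFib P L B → ConstFib P L A :=
  PosetColim.lift (constSys P L B)
    (fun Y b => fibMk P (X.join Y) (P.re (act (le_join_left X Y) (le_join_right X Y) f) b))
    (fun _ _ h b => reAux_compat P _ _ _ _ h f b)

theorem reAux_mk {A B : C} {X Y Z : ConstList C L} (hX : X ≤ Z) (hY : Y ≤ Z)
    (f : X.dom ⨯ A ⟶ B) (b : P.Fib (Y.dom ⨯ B)) :
    reAux P X f (fibMk P Y b) = fibMk P Z (P.re (act hX hY f) b) := by
  refine (reAux_compat P (le_join_left X Y) (le_join_right X Y) hX hY le_rfl f b).trans ?_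
  rw [projTimes_refl, P.re_id]

/-- Reindexing along an arrow of the category with the new constants. -/
def constRe {A B : ConstCat C L} (f : A ⟶ B) : ConstFib P L B.of →o ConstFib P L A.of where
  toFun := Quotient.lift (s := homSetoid A.of B.of) (fun f => reAux P f.1 f.2) (by
    rintro ⟨X, f⟩ ⟨X', f'⟩ ⟨Z, hX, hX', e⟩
    funext b
    induction b using fib_ind with
    | h Y b =>
      obtain ⟨W, k, hY⟩ := exists_ge_ge Z Y
      change reAux P X f _ = reAux P X' f' _
      rw [reAux_mk P (hX.trans k) hY, reAux_mk P (hX'.trans k) hY]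
      have e' : act (hX.trans k) hY f = act (hX'.trans k) hY f' := by
        apply act_congr
        have := congrArg (fun t => projTimes k A.of ≫ t) e
        simpa only [← Category.assoc, projTimes_trans] using this
      rw [e']) f
  monotone' := by
    induction f using hom_ind with
    | h X f =>
      rintro a b ⟨Y, a, b, rfl, rfl, hab⟩
      change reAux P X f (fibMk P Y a) ≤ reAux P X f (fibMk P Y b)
      rw [reAux_mk P (le_join_left X Y) (le_join_right X Y),
        reAux_mk P (le_join_left X Y) (le_join_right X Y)]
      exact PosetColim.mk_mono _ ((P.re _).monotone hab)

/-- Reindexing is computed in any common list. -/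
theorem constRe_mk {A B : ConstCat C L} {X Y Z : ConstList C L} (hX : X ≤ Z) (hY : Y ≤ Z)
    (f : X.dom ⨯ A.of ⟶ B.of) (b : P.Fib (Y.dom ⨯ B.of)) :
    constRe P (homMk X f : A ⟶ B) (fibMk P Y b) = fibMk P Z (P.re (act hX hY f) b) :=
  reAux_mk P hX hY f b

variable (L) in
/-- The doctrine with the new constants: the directed colimit of the doctrines `P (∏ X ⨯ -)`. -/
def addConsts : Doctrine (ConstCat C L) where
  obj A := PartOrd.of (ConstFib P L A.unop.of)
  map f := PartOrd.ofHom (constRe P f.unop)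
  map_id A := by
    apply PartOrd.ext
    intro a
    induction a using fib_ind with
    | h X a =>
      refine (constRe_mk P (nil_le X) (le_refl X) _ _).trans ?_
      rw [act_id, projTimes_refl, P.re_id]
      rfl
  map_comp {A B D} f g := by
    apply PartOrd.ext
    intro a
    change constRe P (g.unop ≫ f.unop) a = constRe P g.unop (constRe P f.unop a)
    generalize f.unop = f
    generalize g.unop = g
    induction a using fib_ind with
    | h Y a =>
    induction f using hom_ind with
    | h X f =>
    induction g using hom_ind with
    | h V g =>
      obtain ⟨T, hX, hY⟩ := exists_ge_ge X Y
      obtain ⟨Z, hT, hV⟩ := exists_ge_ge T V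
      rw [comp_mk hV (hX.trans hT), constRe_mk P (le_refl Z) (hY.trans hT),
        constRe_mk P (hX.trans hT) (hY.trans hT), constRe_mk P hV (le_refl Z), act_comp,
        P.re_comp]

theorem addConsts_re {A B : ConstCat C L} (f : A ⟶ B) (b : (addConsts P L).Fib B) :
    (addConsts P L).re f b = constRe P f b := rfl

variable [PrimaryDoctrine P]

variable (L) in
/-- Binary meets, computed in a common list. -/
def constInf (A : C) : ConstFib P L A → ConstFib P L A → ConstFib P L A :=
  PosetColim.map₂ (constSys P L A) (fun _ a b => PrimaryDoctrine.inf a b)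
    (fun _ _ _ _ _ => PrimaryDoctrine.re_inf _ _ _)

theorem constInf_mk {A : C} (X : ConstList C L) (a b : P.Fib (X.dom ⨯ A)) :
    constInf P L A (fibMk P X a) (fibMk P X b) = fibMk P X (PrimaryDoctrine.inf a b) :=
  PosetColim.map₂_mk (constSys P L A) _ _ X a b

theorem inf_mono {A : C} {a b a' b' : P.Fib A} (h : a ≤ a') (k : b ≤ b') :
    PrimaryDoctrine.inf a b ≤ PrimaryDoctrine.inf a' b' := by
  refine (PrimaryDoctrine.isGLB_inf a' b').2 ?_
  rintro c (rfl | rfl)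
  · exact ((PrimaryDoctrine.isGLB_inf a b).1 (by simp)).trans h
  · exact ((PrimaryDoctrine.isGLB_inf a b).1 (by simp)).trans k

theorem inf_self {A : C} (a : P.Fib A) : PrimaryDoctrine.inf a a = a :=
  (PrimaryDoctrine.isGLB_inf a a).unique (by simp)

theorem constInf_isGLB {A : C} (a b : ConstFib P L A) : IsGLB {a, b} (constInf P L A a b) := by
  induction a, b using fib_ind₂ with
  | h X a b =>
    rw [constInf_mk]
    constructor
    · rintro c (rfl | rfl)
      · exact PosetColim.mk_mono _ ((PrimaryDoctrine.isGLB_inf a b).1 (by simp))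
      · exact PosetColim.mk_mono _ ((PrimaryDoctrine.isGLB_inf a b).1 (by simp))
    · intro c hc
      have h₁ : c ≤ fibMk P X a := hc (by simp)
      have h₂ : c ≤ fibMk P X b := hc (by simp)
      induction c using fib_ind with
      | h Y c =>
        obtain ⟨Z, hX, hY⟩ := exists_ge_ge X Y
        rw [← fibMk_re P hX, ← fibMk_re P hY, fibMk_le] at h₁ h₂
        rw [← fibMk_re P hX, ← fibMk_re P hY, fibMk_le]
        obtain ⟨U, hU, h₁⟩ := h₁
        obtain ⟨V, hV, h₂⟩ := h₂
        obtain ⟨W, hUW, hVW⟩ := exists_ge_ge U V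
        refine ⟨W, hU.trans hUW, ?_⟩
        rw [PrimaryDoctrine.re_inf, PrimaryDoctrine.re_inf]
        refine (PrimaryDoctrine.isGLB_inf _ _).2 ?_
        have h₁' := (P.re (projTimes hUW A)).monotone h₁
        have h₂' := (P.re (projTimes hVW A)).monotone h₂
        simp only [← P.re_comp, projTimes_trans] at h₁' h₂' ⊢
        rintro d (rfl | rfl)
        · exact h₁'
        · exact h₂'

instance : PrimaryDoctrine (addConsts P L) where
  inf {A} a b := constInf P L A.of a b
  top A := fibMk P nil (PrimaryDoctrine.top _)
  isGLB_inf a b := constInf_isGLB P a b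
  isTop_top A a := by
    induction a using fib_ind with
    | h X a =>
      rw [← fibMk_re P (nil_le X), PrimaryDoctrine.re_top]
      exact PosetColim.mk_mono _ (PrimaryDoctrine.isTop_top _ a)
  re_inf {A B} f a b := by
    change constRe P f (constInf P L B.of a b) =
      constInf P L A.of (constRe P f a) (constRe P f b)
    induction f using hom_ind with
    | h X f =>
    induction a, b using fib_ind₂ with
    | h Y a b =>
      obtain ⟨Z, hX, hY⟩ := exists_ge_ge X Y
      rw [constInf_mk, constRe_mk P hX hY, constRe_mk P hX hY, constRe_mk P hX hY, constInf_mk,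
        PrimaryDoctrine.re_inf]
  re_top {A B} f := by
    induction f using hom_ind with
    | h X f =>
      refine (constRe_mk P (le_refl X) (nil_le X) _ _).trans ?_
      rw [PrimaryDoctrine.re_top]
      refine Eq.trans ?_ (fibMk_re P (nil_le X) _)
      rw [PrimaryDoctrine.re_top]

end AddConstants

/-! ## Adding axioms -/

section AddAxioms

variable {D : Type u} [Category.{v} D] [HasFiniteProducts D]
variable (Q : Doctrine.{u, v, w} D) [PrimaryDoctrine Q]

/-- The meet-semilattice structure of a fiber. -/
instance (A : D) : SemilatticeInf (Q.Fib A) where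
  inf := PrimaryDoctrine.inf
  inf_le_left a b := (PrimaryDoctrine.isGLB_inf a b).1 (by simp)
  inf_le_right a b := (PrimaryDoctrine.isGLB_inf a b).1 (by simp)
  le_inf a b c h k := (PrimaryDoctrine.isGLB_inf b c).2 (by rintro d (rfl | rfl) <;> assumption)

instance (A : D) : OrderTop (Q.Fib A) where
  top := PrimaryDoctrine.top A
  le_top := PrimaryDoctrine.isTop_top A

theorem Doctrine.re_inf {A B : D} (f : A ⟶ B) (a b : Q.Fib B) :
    Q.re f (a ⊓ b) = Q.re f a ⊓ Q.re f b := PrimaryDoctrine.re_inf f a b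

variable {t : D} (ht : IsTerminal t) {κ : Type*} (ψ : κ → Q.Fib t)

/-- The reindexing over `A` of the conjunction of the axioms `ψ i`, `i ∈ U`. -/
def axiomsOver (U : Finset κ) (A : D) : Q.Fib A := Q.re (ht.from A) (U.inf ψ)

theorem axiomsOver_anti {U V : Finset κ} (h : U ⊆ V) (A : D) :
    axiomsOver Q ht ψ V A ≤ axiomsOver Q ht ψ U A :=
  (Q.re _).monotone (Finset.inf_mono h)

theorem re_axiomsOver (U : Finset κ) {A B : D} (f : A ⟶ B) :
    Q.re f (axiomsOver Q ht ψ U B) = axiomsOver Q ht ψ U A := by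
  rw [axiomsOver, ← Q.re_comp, ht.hom_ext (f ≫ ht.from B) (ht.from A), axiomsOver]

/-- The fiber over `A` after adding the axioms in `U`: the elements below their conjunction. -/
abbrev AxFib (U : Finset κ) (A : D) : Type w := Set.Iic (axiomsOver Q ht ψ U A)

/-- Passing from the axioms in `U` to those in `V ⊇ U`: conjunction with the latter. -/
def axSys (A : D) (U V : Finset κ) (_ : U ≤ V) : AxFib Q ht ψ U A →o AxFib Q ht ψ V A where
  toFun a := ⟨a.1 ⊓ axiomsOver Q ht ψ V A, inf_le_right⟩
  monotone' _ _ h := inf_le_inf_right _ h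

instance : IsDirectedOrder (Finset κ) where
  directed U V := by
    classical
    exact ⟨U ∪ V, Finset.subset_union_left, Finset.subset_union_right⟩

instance (A : D) : DirectedSystem (fun U : Finset κ => (AxFib Q ht ψ U A : Type w))
    (axSys Q ht ψ A · · ·) where
  map_self _ a := Subtype.ext (inf_eq_left.2 a.2)
  map_map _ _ _ h k a := Subtype.ext (by
    change (a.1 ⊓ _) ⊓ _ = a.1 ⊓ _
    rw [inf_assoc, inf_eq_right.2 (axiomsOver_anti Q ht ψ k A)])

/-- The fiber over `A` after adding all the axioms. -/
abbrev AxColim (A : D) : Type _ :=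
  PosetColim (F := fun U : Finset κ => (AxFib Q ht ψ U A : Type w)) (axSys Q ht ψ A)

/-- The class of an element `a` below the conjunction of the axioms in `U`. -/
def axMk {A : D} (U : Finset κ) (a : AxFib Q ht ψ U A) : AxColim Q ht ψ A :=
  PosetColim.mk (axSys Q ht ψ A) U a

/-- Reindexing with the axioms in `U`. -/
def axStageRe (U : Finset κ) {A B : D} (f : A ⟶ B) (b : AxFib Q ht ψ U B) : AxFib Q ht ψ U A :=
  ⟨Q.re f b.1, (re_axiomsOver Q ht ψ U f).le.trans' ((Q.re f).monotone b.2)⟩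

/-- Reindexing after adding all the axioms. -/
def axRe {A B : D} (f : A ⟶ B) : AxColim Q ht ψ B →o AxColim Q ht ψ A where
  toFun := PosetColim.lift (axSys Q ht ψ B) (fun U b => axMk Q ht ψ U (axStageRe Q ht ψ U f b))
    (fun U V h b => by
      refine (PosetColim.mk_map (axSys Q ht ψ A) h _).symm.trans ?_
      refine congrArg (PosetColim.mk (axSys Q ht ψ A) V) (Subtype.ext ?_)
      change Q.re f b.1 ⊓ _ = Q.re f (b.1 ⊓ _)
      rw [Q.re_inf, re_axiomsOver])
  monotone' := by
    rintro a b ⟨U, a, b, rfl, rfl, hab⟩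
    exact PosetColim.mk_mono _ ((Q.re f).monotone hab : Q.re f a.1 ≤ Q.re f b.1)

/-- The doctrine obtained by adding all the axioms `ψ i`: the directed colimit, over the finite
sets `U`, of the doctrines obtained by adding the conjunction of the axioms in `U`. -/
def addAxioms : Doctrine D where
  obj A := PartOrd.of (AxColim Q ht ψ A.unop)
  map f := PartOrd.ofHom (axRe Q ht ψ f.unop)
  map_id A := by
    apply PartOrd.ext
    intro a
    induction a using PosetColim.ind with
    | h U a => exact congrArg (PosetColim.mk _ U) (Subtype.ext (Q.re_id a.1))
  map_comp f g := by
    apply PartOrd.ext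
    intro a
    induction a using PosetColim.ind with
    | h U a => exact congrArg (PosetColim.mk _ U) (Subtype.ext (Q.re_comp g.unop f.unop a.1))

end AddAxioms

/-! ## Henkin axioms -/

section Henkin

open ConstList ConstCat

variable {C : Type u} [Category.{v} C] [HasFiniteProducts C]

/-- The well-ordered set of ordinals below the cardinality of the disjoint union of the fibers. -/
abbrev Doctrine.Labels (P : Doctrine.{u, v, w} C) : Type (max u w) :=
  (Cardinal.mk (Σ A : C, P.Fib A)).ord.ToType

variable (P : Doctrine.{u, v, w} C) [ImplicationalDoctrine P] [ExistentialDoctrine P]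

/-- For each object `B`, a listing `j ↦ [φ B j, X B j]`, indexed by the labels, of all elements of
the fiber over `B` of the doctrine with the new constants, together with the labels `d B j` of the
witnesses: `d B j` is the smallest label greater than all `d B h`, `h < j`, and than all labels
occurring in the lists `X B k`, `k ≤ j`. -/
structure HenkinListing where
  X : C → P.Labels → ConstList C P.Labels
  φ : ∀ (B : C) (j : P.Labels), P.Fib ((X B j).dom ⨯ B)
  exhaustive : ∀ (B : C) (a : (addConsts P P.Labels).Fib ⟨B⟩), ∃ j, fibMk P (X B j) (φ B j) = a
  d : C → P.Labels → P.Labels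
  d_isLeast : ∀ (B : C) (j : P.Labels), IsLeast
    {o | (∀ h < j, d B h < o) ∧ ∀ k ≤ j, ∀ p ∈ (X B k).1, p.2 < o} (d B j)

namespace HenkinListing

variable {P} (H : HenkinListing P) (B : C) (j : P.Labels)

theorem fresh : (B, H.d B j) ∉ (H.X B j).1 := fun h =>
  lt_irrefl _ ((H.d_isLeast B j).1.2 j le_rfl _ h)

/-- The list `X B j` with the entry `(B, d B j)` added. -/
def star : ConstList C P.Labels :=
  ⟨(H.X B j).1 ++ [(B, H.d B j)],
    List.nodup_append'.2 ⟨(H.X B j).2, List.nodup_singleton _, by simpa using H.fresh B j⟩⟩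

theorem le_star : H.X B j ≤ H.star B j := List.subset_append_left _ _

/-- The identification of `∏ (star B j) ⨯ t`, `t` terminal, with `∏ (X B j) ⨯ B`. -/
def starMap : (H.star B j).dom ⨯ (⊤_ C) ⟶ (H.X B j).dom ⨯ B :=
  prod.lift (prod.fst ≫ proj (H.le_star B j))
    (prod.fst ≫ (H.star B j).π ⟨(B, H.d B j), by simp [star]⟩)

/-- The formula `(∃ φ B j) → φ B j` over `∏ (X B j) ⨯ B`. -/
def ψ : P.Fib ((H.X B j).dom ⨯ B) :=
  ImplicationalDoctrine.imp (P.re prod.fst (ExistentialDoctrine.ex (H.φ B j))) (H.φ B j)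

/-- The Henkin axiom: the class of `ψ B j` with respect to the list `star B j`, so that the new
constant `(B, d B j)` is substituted for the variable of sort `B`. -/
def henkinAxiom : (addConsts P P.Labels).Fib ⟨⊤_ C⟩ :=
  fibMk P (H.star B j) (P.re (H.starMap B j) (H.ψ B j))

/-- The doctrine obtained by adding all the Henkin axioms to the doctrine with new constants. -/
def richDoctrine : Doctrine (ConstCat C P.Labels) :=
  addAxioms (addConsts P P.Labels) isTerminal
    (fun i : C × P.Labels => H.henkinAxiom i.1 i.2)

end HenkinListing

end Henkin

end

/-! ## Consistency after adding the Henkin axioms -/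

section Consistency

open ConstList ConstCat

variable {C : Type u} [Category.{v} C] [HasFiniteProducts C]

/-! Consistency. An inequality in the final colimit already holds after adding finitely many Henkin
axioms, so it suffices that no finite conjunction of them is below `⊥`. By induction on the finite
set, remove the axiom with the largest witness label. Its witness `c` is fresh for all the others,
whose conjunction is therefore some `θ` not mentioning `c`. If `θ ∧ (∃φ → φ(c)) ≤ ⊥`, replace `c` by
a variable `y` of sort `B`. From `φ ≤ (∃φ → φ)` it follows that `φ ≤ ¬θ`, hence `∃φ ≤ ¬θ` by
adjunction. So `θ` implies `¬∃φ`, hence also `∃φ → φ`, and `θ ≤ ⊥`. With no axioms left, `⊤ ≤ ⊥`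
would hold in some fiber of `P`, which is nontrivial. The steps are `le_bot_of_inf_henkin_le_bot`,
`le_bot_of_inf_henkinAxiom_le_bot` and `not_inf_henkinAxiom_le_bot`.

Existence. It is enough to list each element at a position `j` above all labels in its
representative; then `d B j = j`. For infinite `Λ` there are at most `Λ` representatives, each can
be offered `Λ` candidate positions, and these are unbounded because `Λ` is an initial ordinal. For
finite `Λ` room is scarce. Let `T` be the product of all objects, so that the constants with the
first `n` labels have product `Tⁿ`. With finitely many objects, two such powers with exponents `0 <
k < l ≤ |C| + 1` coincide, every later power is a retract of `Tᵏ`, and so every element is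
represented with labels below `k ≤ |C|`. Since each fiber has at least two elements, the positions
from `k` on are numerous enough to hold everything except `⊤`, which goes to position `0`. -/

/-- Over `A ⨯ B`, a formula `θ` on `A` which refutes `(∃ φ) → φ` is refuted itself. -/
theorem le_bot_of_inf_henkin_le_bot (P : Doctrine.{u, v, w} C) [HeytingDoctrine P]
    [ExistentialDoctrine P] {A B : C} (θ : P.Fib A) (φ : P.Fib (A ⨯ B))
    (h : P.re prod.fst θ ⊓ ImplicationalDoctrine.imp
      (P.re prod.fst (ExistentialDoctrine.ex φ)) φ ≤ HeytingDoctrine.bot _) :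
    P.re prod.fst θ ≤ HeytingDoctrine.bot (A ⨯ B) := by
  have imp_iff : ∀ {D : C} (a b c : P.Fib D), a ≤ ImplicationalDoctrine.imp b c ↔ a ⊓ b ≤ c :=
    ImplicationalDoctrine.le_imp_iff
  -- Since `φ` implies `∃φ → φ`, it contradicts `θ`. The bound `¬θ` comes from `A`, so the
  -- adjunction applies to it.
  have h₁ : φ ≤ P.re prod.fst (ImplicationalDoctrine.imp θ (HeytingDoctrine.bot A)) := by
    rw [ImplicationalDoctrine.re_imp, HeytingDoctrine.re_bot, imp_iff]
    refine le_trans (le_inf inf_le_right (inf_le_left.trans ?_)) h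
    exact (imp_iff _ _ _).2 inf_le_left
  have h₂ := (imp_iff _ _ _).1 ((ExistentialDoctrine.gc A B _ _).2 h₁)
  have h₃ := (P.re (prod.fst : A ⨯ B ⟶ A)).monotone h₂
  rw [P.re_inf, HeytingDoctrine.re_bot] at h₃
  -- As `θ` refutes `∃φ`, it implies `∃φ → φ` vacuously, which by hypothesis it refutes.
  refine le_trans (le_inf le_rfl ((imp_iff _ _ _).2 ?_)) h
  rw [inf_comm]
  exact h₃.trans (HeytingDoctrine.isBot_bot _ _)

/-- A Henkin axiom whose witness does not occur in `Y` is compatible with every formula over `Y`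
which is compatible with the new constants. -/
theorem HenkinListing.le_bot_of_inf_henkinAxiom_le_bot {P : Doctrine.{u, v, w} C}
    [HeytingDoctrine P] [ExistentialDoctrine P] (H : HenkinListing P) (B : C) (j : P.Labels)
    {Y : ConstList C P.Labels} (hY : (B, H.d B j) ∉ Y.1)
    (θ : P.Fib (Y.dom ⨯ (⊤_ C)))
    (h : constInf P P.Labels _ (fibMk P Y θ) (H.henkinAxiom B j) ≤
      fibMk P nil (HeytingDoctrine.bot _)) :
    fibMk P Y θ ≤ fibMk P nil (HeytingDoctrine.bot _) := by
  classical
  obtain ⟨Z₀, hY₀, hs₀⟩ := exists_ge_ge Y (H.star B j)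
  rw [henkinAxiom, ← fibMk_re P hY₀, ← fibMk_re P hs₀, constInf_mk,
    ← fibMk_re P (nil_le Z₀), fibMk_le] at h
  obtain ⟨Z, hZ, h⟩ := h
  rw [PrimaryDoctrine.re_inf, ← P.re_comp, ← P.re_comp, projTimes_trans, projTimes_trans,
    HeytingDoctrine.re_bot, HeytingDoctrine.re_bot, ← P.re_comp] at h
  have hYZ : Y ≤ Z := hY₀.trans hZ
  have hsZ : H.star B j ≤ Z := hs₀.trans hZ
  -- The context `Z` without the witness; it still contains `Y` and `X B j`, neither of which
  -- mentions it.
  let W : ConstList C P.Labels := ⟨Z.1.filter (· ≠ (B, H.d B j)), Z.2.filter _⟩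
  have hWZ : W ≤ Z := List.filter_subset_self _
  have hYW : Y ≤ W := fun p hp => List.mem_filter.2
    ⟨hYZ hp, by simpa using fun e : p = (B, H.d B j) => hY (e ▸ hp)⟩
  have hXW : H.X B j ≤ W := fun p hp => List.mem_filter.2
    ⟨hsZ (H.le_star B j hp), by simpa using fun e : p = (B, H.d B j) => H.fresh B j (e ▸ hp)⟩
  have hc : (B, H.d B j) ∈ Z.1 := hsZ (by simp [star])
  have memW : ∀ p ∈ Z.1, p ≠ (B, H.d B j) → p ∈ W.1 := fun p hp hne =>
    List.mem_filter.2 ⟨hp, by simpa using hne⟩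
  -- substitution of the variable of sort `B` for the witness
  let k : W.dom ⨯ B ⟶ Z.dom := Z.lift fun p =>
    if e : p.1 = (B, H.d B j) then prod.snd ≫ eqToHom (congrArg Prod.fst e).symm
    else prod.fst ≫ W.π ⟨p.1, memW p.1 p.2 e⟩
  have k_of_ne : ∀ (p) (hp : p ∈ W.1), k ≫ Z.π ⟨p, hWZ hp⟩ = prod.fst ≫ W.π ⟨p, hp⟩ := by
    intro p hp
    have e : p ≠ (B, H.d B j) := by simpa using (List.mem_filter.1 hp).2
    simp [k, e]
  have k_c : k ≫ Z.π ⟨_, hc⟩ = prod.snd := by simp [k]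
  let m : W.dom ⨯ B ⟶ Z.dom ⨯ (⊤_ C) := prod.lift k (terminal.from _)
  let r : W.dom ⟶ Y.dom ⨯ (⊤_ C) := prod.lift (proj hYW) (terminal.from _)
  have hm₁ : m ≫ projTimes hYZ _ = prod.fst ≫ r := by
    apply prod_hom_ext
    · rw [Category.assoc, projTimes_fst, Category.assoc, prod.lift_fst, prod.lift_fst_assoc]
      refine Y.hom_ext _ _ fun p => ?_
      rw [Category.assoc, proj_π, Category.assoc, proj_π]
      exact k_of_ne p.1 (hYW p.2)
    · exact Subsingleton.elim _ _
  have hm₂ : m ≫ projTimes hsZ _ ≫ H.starMap B j = projTimes hXW B := by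
    apply prod_hom_ext
    · rw [Category.assoc, Category.assoc, starMap, prod.lift_fst, reassoc_of% (projTimes_fst hsZ),
        prod.lift_fst_assoc, projTimes_fst]
      refine (H.X B j).hom_ext _ _ fun p => ?_
      simp only [Category.assoc, proj_π]
      exact k_of_ne p.1 (hXW p.2)
    · rw [Category.assoc, Category.assoc, starMap, prod.lift_snd, reassoc_of% (projTimes_fst hsZ),
        prod.lift_fst_assoc, projTimes_snd, proj_π]
      exact k_c
  -- Beck–Chevalley turns the reindexed `∃φ` into the quantification over `W` of the reindexed `φ`,
  -- the form required by `le_bot_of_inf_henkin_le_bot`.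
  have h' := (P.re m).monotone h
  rw [PrimaryDoctrine.re_inf, HeytingDoctrine.re_bot, ← P.re_comp, ← P.re_comp, hm₁, hm₂,
    P.re_comp prod.fst r, ψ, ImplicationalDoctrine.re_imp,
    ← P.re_comp (projTimes hXW B) prod.fst, projTimes_fst, P.re_comp prod.fst (proj hXW),
    ← ExistentialDoctrine.beckChevalley] at h'
  -- This refutes `θ` over `W ⨯ B` only. It need not descend to `W`, since the projection may have
  -- no section; in the larger context `Z` the witness itself supplies a value of sort `B`.
  have h'' := le_bot_of_inf_henkin_le_bot P _ _ h'
  -- substitution of the witness for the variable of sort `B`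
  let n : Z.dom ⨯ (⊤_ C) ⟶ W.dom ⨯ B := prod.lift (prod.fst ≫ proj hWZ) (prod.fst ≫ Z.π ⟨_, hc⟩)
  have hn : n ≫ prod.fst ≫ r = projTimes hYZ _ := by
    apply prod_hom_ext
    · rw [prod.lift_fst_assoc, Category.assoc, Category.assoc, prod.lift_fst, projTimes_fst,
        proj_trans]
    · exact Subsingleton.elim _ _
  have h₃ := (P.re n).monotone h''
  rw [← P.re_comp, ← P.re_comp, Category.assoc, hn, HeytingDoctrine.re_bot] at h₃
  rw [← fibMk_re P (nil_le Y), fibMk_le]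
  refine ⟨Z, hYZ, ?_⟩
  rwa [HeytingDoctrine.re_bot, HeytingDoctrine.re_bot]

/-! ### Finite sets of Henkin axioms -/

namespace HenkinListing

variable {P : Doctrine.{u, v, w} C} [ImplicationalDoctrine P] [ExistentialDoctrine P]
  (H : HenkinListing P)

/-- Ensures that different axioms of the same sort have different witnesses. -/
theorem d_strictMono (B : C) : StrictMono (H.d B) := fun _ j h => (H.d_isLeast B j).1.1 _ h

/-- The conjunction of finitely many Henkin axioms is represented over a list of constants that
avoids a given constant, if the axioms do so. -/
theorem exists_fibMk_eq_inf (c : C × P.Labels) (U : Finset (C × P.Labels))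
    (hU : ∀ i ∈ U, c ∉ (H.star i.1 i.2).1) :
    ∃ (Y : ConstList C P.Labels) (_ : c ∉ Y.1) (θ : P.Fib (Y.dom ⨯ (⊤_ C))),
      (U.inf fun i => H.henkinAxiom i.1 i.2) = fibMk P Y θ := by
  classical
  induction U using Finset.induction_on with
  | empty => exact ⟨nil, List.not_mem_nil, PrimaryDoctrine.top _, rfl⟩
  | insert i U _ ih =>
    obtain ⟨Y, hc, θ, e⟩ := ih fun i hi => hU i (Finset.mem_insert_of_mem hi)
    -- An arbitrary upper bound of the two lists might contain `c`, so their union is formed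
    -- explicitly.
    let Z : ConstList C P.Labels := ⟨(Y.1 ++ (H.star i.1 i.2).1).dedup, List.nodup_dedup _⟩
    have hY : Y ≤ Z := fun p hp => List.mem_dedup.2 (List.mem_append_left _ hp)
    have hi : H.star i.1 i.2 ≤ Z := fun p hp => List.mem_dedup.2 (List.mem_append_right _ hp)
    refine ⟨Z, fun h => ?_, PrimaryDoctrine.inf (P.re (projTimes hi _)
      (P.re (H.starMap i.1 i.2) (H.ψ i.1 i.2))) (P.re (projTimes hY _) θ), ?_⟩
    · rcases List.mem_append.1 (List.mem_dedup.1 h) with h | h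
      · exact hc h
      · exact hU i (Finset.mem_insert_self _ _) h
    · rw [Finset.inf_insert, e, henkinAxiom, ← fibMk_re P hY, ← fibMk_re P hi]
      exact constInf_mk P Z _ _

end HenkinListing

/-- Finitely many Henkin axioms are jointly consistent. -/
theorem HenkinListing.not_inf_henkinAxiom_le_bot {P : Doctrine.{u, v, w} C}
    [HeytingDoctrine P] [ExistentialDoctrine P] (H : HenkinListing P)
    (hP : P.HasNontrivialFibers) (U : Finset (C × P.Labels)) :
    ¬ (U.inf fun i => H.henkinAxiom i.1 i.2) ≤ fibMk P nil (HeytingDoctrine.bot _) := by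
  classical
  induction U using Finset.strongInduction with
  | H U ih =>
    rcases U.eq_empty_or_nonempty with rfl | hne
    · intro h
      obtain ⟨Z, hZ, h⟩ := (fibMk_le P (a := PrimaryDoctrine.top _)).1 h
      rw [PrimaryDoctrine.re_top, HeytingDoctrine.re_bot] at h
      obtain ⟨a, b, hab⟩ := hP (Z.dom ⨯ (⊤_ C))
      have key : ∀ a b : P.Fib (Z.dom ⨯ (⊤_ C)), a ≤ b := fun a b =>
        (PrimaryDoctrine.isTop_top _ a).trans (h.trans (HeytingDoctrine.isBot_bot _ b))
      exact hab (le_antisymm (key a b) (key b a))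
    -- Choosing the largest witness label makes this witness fresh for the other axioms. Constants
    -- inside their formulas have labels strictly below their own witness labels, and their own
    -- witnesses differ from this one in sort or, by injectivity of `d`, in label.
    · obtain ⟨⟨B, j⟩, hi, hmax⟩ := U.exists_max_image (fun i => H.d i.1 i.2) hne
      obtain ⟨Y, hY, θ, e⟩ := H.exists_fibMk_eq_inf (B, H.d B j) (U.erase (B, j)) (by
        rintro ⟨B', j'⟩ hi' hmem
        obtain ⟨hne', hi'⟩ := Finset.mem_erase.1 hi'
        rcases List.mem_append.1 hmem with hmem | hmem
        · exact ((H.d_isLeast B' j').1.2 j' le_rfl _ hmem).not_ge (hmax _ hi')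
        · obtain ⟨rfl, e⟩ := Prod.mk.inj (List.mem_singleton.1 hmem)
          exact hne' (by rw [(H.d_strictMono _).injective e]))
      intro h
      refine ih _ (Finset.erase_ssubset hi) ?_
      rw [← Finset.insert_erase hi, Finset.inf_insert, inf_comm, e] at h
      rw [e]
      exact H.le_bot_of_inf_henkinAxiom_le_bot B j hY θ h

/-! ### Passage to the colimit over all axioms -/

/-- Adding axioms whose finite conjunctions are not below a fixed element yields a consistent
doctrine. -/
theorem addAxioms_isConsistent {D : Type u} [Category.{v} D] [HasFiniteProducts D]
    (Q : Doctrine.{u, v, w} D) [PrimaryDoctrine Q] {t : D} (ht : IsTerminal t) {κ : Type*}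
    (ψ : κ → Q.Fib t) (b : Q.Fib t) (h : ∀ U : Finset κ, ¬ U.inf ψ ≤ b) :
    (addAxioms Q ht ψ).IsConsistent := by
  let R := addAxioms Q ht ψ
  let x : R.Fib t := axMk Q ht ψ ∅ ⟨axiomsOver Q ht ψ ∅ t, le_rfl⟩
  let y : R.Fib t := axMk Q ht ψ ∅ ⟨b ⊓ axiomsOver Q ht ψ ∅ t, inf_le_right⟩
  -- Consistency refers to the chosen terminal object, while the axioms live over `t`; the
  -- inequality is carried back along the comparison arrow.
  refine ⟨R.re (ht.from _) x, R.re (ht.from _) y, fun hle => ?_⟩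
  have hle' := (R.re (terminal.from t)).monotone hle
  rw [← R.re_comp, ← R.re_comp, ht.hom_ext (_ ≫ _) (𝟙 t), R.re_id, R.re_id] at hle'
  obtain ⟨V, hV, hle'⟩ := (PosetColim.mk_le_mk (axSys Q ht ψ t)).1 hle'
  have hle'' : axiomsOver Q ht ψ ∅ t ⊓ axiomsOver Q ht ψ V t ≤
    b ⊓ axiomsOver Q ht ψ ∅ t ⊓ axiomsOver Q ht ψ V t := hle'
  have e : axiomsOver Q ht ψ V t = V.inf ψ := by
    rw [axiomsOver, ht.hom_ext (ht.from t) (𝟙 t), Q.re_id]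
  refine h V ?_
  rw [← e]
  exact ((le_inf (axiomsOver_anti Q ht ψ hV t) le_rfl).trans hle'').trans
    (inf_le_left.trans inf_le_left)

end Consistency

/-! ## Existence of listings -/

section Existence

open ConstList ConstCat Cardinal

variable {C : Type u} [Category.{v} C] [HasFiniteProducts C]

/-- If the constants in the `j`-th representatives have labels below `j`, then `j` is the label of
the `j`-th witness. -/
theorem HenkinListing.nonempty_of_forall_lt (P : Doctrine.{u, v, w} C) [ImplicationalDoctrine P]
    [ExistentialDoctrine P]
    (h : ∀ B : C, ∃ e : P.Labels → Σ X : ConstList C P.Labels, P.Fib (X.dom ⨯ B),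
      (∀ j, ∀ p ∈ (e j).1.1, p.2 < j) ∧ ∀ a, ∃ j, fibMk P (e j).1 (e j).2 = a) :
    Nonempty (HenkinListing P) := by
  choose e he hsurj using h
  exact ⟨{ X := fun B j => (e B j).1
           φ := fun B j => (e B j).2
           exhaustive := hsurj
           d := fun _ j => j
           -- A label `o < j` cannot be an upper bound, as it would have to exceed `d B o = o`.
           d_isLeast := fun B j => ⟨⟨fun _ h => h, fun k hk p hp => (he B k p hp).trans_le hk⟩,
             fun o ho => le_of_not_gt fun hlt => lt_irrefl _ (ho.1 o hlt)⟩ }⟩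

/-- A listing from representatives with an injective choice of positions; the top element, which
needs no constants, fills the remaining positions. -/
theorem exists_listing_of_injective (P : Doctrine.{u, v, w} C) [PrimaryDoctrine P] (B : C)
    (rep : ConstFib P P.Labels B → Σ X : ConstList C P.Labels, P.Fib (X.dom ⨯ B))
    (hrep : ∀ a, fibMk P (rep a).1 (rep a).2 = a)
    (g : {a : ConstFib P P.Labels B // a ≠ fibMk P nil (PrimaryDoctrine.top _)} → P.Labels)
    (hg : Function.Injective g) (hlt : ∀ a, ∀ p ∈ (rep a.1).1.1, p.2 < g a)
    (j₀ : P.Labels) (hj₀ : ∀ a, g a ≠ j₀) :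
    ∃ e : P.Labels → Σ X : ConstList C P.Labels, P.Fib (X.dom ⨯ B),
      (∀ j, ∀ p ∈ (e j).1.1, p.2 < j) ∧ ∀ a, ∃ j, fibMk P (e j).1 (e j).2 = a := by
  classical
  refine ⟨Function.extend g (fun a => rep a.1) fun _ => ⟨nil, PrimaryDoctrine.top _⟩, ?_, ?_⟩
  · intro j p hp
    by_cases hj : ∃ a, g a = j
    · obtain ⟨a, rfl⟩ := hj
      rw [hg.extend_apply] at hp
      exact hlt a p hp
    · rw [Function.extend_apply' _ _ _ hj] at hp
      exact absurd hp List.not_mem_nil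
  · intro a
    by_cases ha : a = fibMk P nil (PrimaryDoctrine.top _)
    · refine ⟨j₀, ?_⟩
      rw [Function.extend_apply' _ _ _ (fun ⟨a, h⟩ => hj₀ a h), ha]
    · refine ⟨g ⟨a, ha⟩, ?_⟩
      rw [hg.extend_apply]
      exact hrep a

/-! ### Infinitely many labels: cardinal arithmetic -/

/-- Listings over infinitely many labels. -/
theorem exists_listing_of_infinite (P : Doctrine.{u, v, w} C) [PrimaryDoctrine P]
    (hP : P.HasNontrivialFibers) [Infinite (Σ A : C, P.Fib A)] (B : C) :
    ∃ e : P.Labels → Σ X : ConstList C P.Labels, P.Fib (X.dom ⨯ B),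
      (∀ j, ∀ p ∈ (e j).1.1, p.2 < j) ∧ ∀ a, ∃ j, fibMk P (e j).1 (e j).2 = a := by
  classical
  have e₀ : P.Labels ≃ Σ A : C, P.Fib A := (Cardinal.eq.1 (mk_ord_toType _)).some
  have : Infinite P.Labels := .of_injective _ e₀.symm.injective
  -- Nonempty fibers let objects be coded by labels, which bounds the number of lists of constants.
  let s : C → P.Labels := fun A => e₀.symm ⟨A, (hP A).to_nonempty.some⟩
  have hs : Function.Injective s := fun A A' h => congrArg Sigma.fst (e₀.symm.injective h)
  let E := Σ X : ConstList C P.Labels, P.Fib (X.dom ⨯ B)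
  let i₁ : E → List (P.Labels × P.Labels) × P.Labels := fun x =>
    (x.1.1.map (Prod.map s id), e₀.symm ⟨x.1.dom ⨯ B, x.2⟩)
  have hi₁ : Function.Injective i₁ := by
    rintro ⟨⟨X, hX⟩, φ⟩ ⟨⟨Y, hY⟩, ψ⟩ h
    obtain ⟨h₁, h₂⟩ := Prod.mk.inj h
    obtain rfl : X = Y := (hs.prodMap Function.injective_id).list_map h₁
    obtain rfl : φ = ψ := eq_of_heq (Sigma.mk.inj (e₀.symm.injective h₂)).2
    rfl
  -- The extra factor gives every representative `Λ` many candidate positions, with no clash between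
  -- different representatives.
  have hcard : #(E × P.Labels) ≤ #P.Labels := by
    have hsq : #P.Labels * #P.Labels = #P.Labels := mul_eq_self (aleph0_le_mk _)
    have h₁ : #(List (P.Labels × P.Labels)) = #P.Labels := by
      rw [mk_list_eq_mk, mk_prod, lift_id, hsq]
    have h₂ : #E ≤ #P.Labels := (mk_le_of_injective hi₁).trans_eq (by
      rw [mk_prod, h₁, lift_id, hsq])
    rw [mk_prod, lift_id, lift_id]
    exact (mul_le_mul_left h₂ _).trans_eq hsq
  obtain ⟨i⟩ := hcard
  have hnat : Nonempty P.Labels := inferInstance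
  have key : ∀ x : E, ∃ l : P.Labels, (∀ p ∈ x.1.1, p.2 < i (x, l)) ∧ i (x, l) ≠ hnat.some := by
    intro x
    by_contra! hcon
    -- If every candidate fails, all of them lie below the maximum of the finitely many labels of
    -- `x` and the position reserved for `⊤`. Then `Λ` would inject into a proper initial segment,
    -- which has smaller cardinality.
    let M := x.1.1.toFinset.image Prod.snd ∪ {hnat.some}
    have hMne : M.Nonempty := ⟨hnat.some, by simp [M]⟩
    have hle : ∀ l, i (x, l) ≤ M.max' hMne := by
      intro l
      by_cases h : ∀ p ∈ x.1.1, p.2 < i (x, l)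
      · rw [hcon l h]
        exact M.le_max' _ (by simp [M])
      · push Not at h
        obtain ⟨p, hp, h⟩ := h
        refine h.trans (M.le_max' _ ?_)
        exact Finset.mem_union_left _ (Finset.mem_image_of_mem _ (List.mem_toFinset.2 hp))
    have hnomax : NoMaxOrder P.Labels := Cardinal.noMaxOrder (aleph0_le_mk _)
    obtain ⟨m, hm⟩ := exists_gt (M.max' hMne)
    have h₁ : #P.Labels ≤ #(Set.Iio m) := mk_le_of_injective
      (f := fun l => (⟨i (x, l), (hle l).trans_lt hm⟩ : Set.Iio m))
      (fun l l' h => congrArg Prod.snd (i.injective (congrArg Subtype.val h)))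
    exact absurd h₁ (mk_Iio_lt m (by simp)).not_ge
  choose l hl hl₀ using key
  have hrep : ∀ a : ConstFib P P.Labels B, ∃ x : E, fibMk P x.1 x.2 = a := fun a => by
    induction a using fib_ind with
    | h X a => exact ⟨⟨X, a⟩, rfl⟩
  choose rep hrep using hrep
  refine exists_listing_of_injective P B rep hrep (fun a => i (rep a.1, l (rep a.1))) ?_
    (fun a => hl _) hnat.some fun a => hl₀ _
  intro a a' h
  have h' : rep a.1 = rep a'.1 := congrArg Prod.fst (i.injective h)
  exact Subtype.ext (by rw [← hrep a.1, h', hrep])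

end Existence

/-! ### Finitely many labels: powers of the product of all sorts -/

section FiniteExistence

open ConstList ConstCat

variable {C : Type u} [Category.{v} C] [HasFiniteProducts C]

namespace ConstList

variable {L : Type*}

/-- The projection from a larger list splits if the smaller list has constants of all sorts
involved. -/
theorem exists_section_proj {X Y : ConstList C L} (h : X ≤ Y)
    (hs : ∀ p ∈ Y.1, ∃ x, (p.1, x) ∈ X.1) : ∃ s : X.dom ⟶ Y.dom, s ≫ proj h = 𝟙 _ := by
  classical
  choose x hx using hs
  -- A missing component is filled by copying a constant of the same sort already in `X`; a sort
  -- need not have global elements.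
  refine ⟨Y.lift fun p => if hp : p.1 ∈ X.1 then X.π ⟨p.1, hp⟩ else
    X.π ⟨(p.1.1, x p.1 p.2), hx p.1 p.2⟩, X.hom_ext _ _ fun p => ?_⟩
  rw [Category.assoc, proj_π, lift_π, dif_pos p.2, Category.id_comp]

/-- Reindexing along such a projection is bijective on finite fibers if the larger product is a
retract of the smaller one. -/
theorem bijective_re_projTimes {X Y : ConstList C L} (P : Doctrine.{u, v, w} C) (h : X ≤ Y)
    (hs : ∀ p ∈ Y.1, ∃ x, (p.1, x) ∈ X.1) (r : Retract Y.dom X.dom) (B : C)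
    [Finite (P.Fib (X.dom ⨯ B))] : Function.Bijective (P.re (projTimes h B)) := by
  obtain ⟨s, hs⟩ := exists_section_proj h hs
  have hinj : Function.Injective (P.re (projTimes h B)) := by
    refine Function.LeftInverse.injective (g := P.re (prod.map s (𝟙 B))) fun a => ?_
    rw [← P.re_comp, projTimes, prod.map_map, hs, Category.comp_id, prod.map_id_id, P.re_id]
  have hinj' : Function.Injective (P.re (prod.map r.r (𝟙 B))) := by
    refine Function.LeftInverse.injective (g := P.re (prod.map r.i (𝟙 B))) fun a => ?_
    rw [← P.re_comp, prod.map_map, r.retract, Category.comp_id, prod.map_id_id, P.re_id]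
  have : Finite (P.Fib (Y.dom ⨯ B)) := .of_injective _ hinj'
  -- The fibers inject into each other, by unrelated maps, so they have equal finite cardinality and
  -- the first injection is bijective.
  exact (Nat.bijective_iff_injective_and_card _).2
    ⟨hinj, le_antisymm (Nat.card_le_card_of_injective _ hinj)
      (Nat.card_le_card_of_injective _ hinj')⟩

variable [Finite C] [Finite L] {N : ℕ} (e : L ≃ Fin N)

variable (C) in
/-- A list of all constants whose label is among the first `n`. -/
noncomputable def initial (n : ℕ) : ConstList C L :=
  ⟨(Set.toFinite {p : C × L | (e p.2 : ℕ) < n}).toFinset.toList, Finset.nodup_toList _⟩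

theorem mem_initial {n : ℕ} {p : C × L} : p ∈ (initial C e n).1 ↔ (e p.2 : ℕ) < n := by
  simp [initial]

theorem initial_mono {m n : ℕ} (h : m ≤ n) : initial C e m ≤ initial C e n := fun _ hp =>
  (mem_initial e).2 (((mem_initial e).1 hp).trans_le h)

/-- One more label amounts to one more constant of each sort. -/
noncomputable def initialSuccIso {n : ℕ} (hn : n < N) :
    (initial C e (n + 1)).dom ≅ (initial C e n).dom ⨯ ∏ᶜ fun A : C => A := by
  classical
  have hx : ∀ A : C, (A, e.symm ⟨n, hn⟩) ∈ (initial C e (n + 1)).1 := fun A => by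
    simp [mem_initial]
  exact
    { hom := prod.lift (proj (initial_mono e n.le_succ))
        (Limits.Pi.lift fun A => (initial C e (n + 1)).π ⟨(A, e.symm ⟨n, hn⟩), hx A⟩)
      inv := (initial C e (n + 1)).lift fun p =>
        if hp : p.1 ∈ (initial C e n).1 then prod.fst ≫ (initial C e n).π ⟨p.1, hp⟩
        else prod.snd ≫ Limits.Pi.π (fun A : C => A) p.1.1
      hom_inv_id := by
        refine hom_ext _ _ _ fun p => ?_
        rw [Category.assoc, lift_π, Category.id_comp]
        split_ifs with hp
        · rw [prod.lift_fst_assoc, proj_π]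
        · rw [prod.lift_snd_assoc, Limits.Pi.lift_π]
          obtain ⟨⟨A, x⟩, hAx⟩ := p
          -- An entry of stage `n + 1` outside stage `n` carries exactly the label numbered `n`.
          obtain rfl : x = e.symm ⟨n, hn⟩ := by
            rw [mem_initial] at hp hAx
            dsimp only at hp hAx
            refine e.injective (Fin.ext ?_)
            simp only [Equiv.apply_symm_apply]
            omega
          rfl
      inv_hom_id := by
        apply prod_hom_ext
        · rw [Category.assoc, prod.lift_fst, Category.id_comp]
          refine hom_ext _ _ _ fun p => ?_
          rw [Category.assoc, proj_π, lift_π, dif_pos p.2]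
        · rw [Category.assoc, prod.lift_snd, Category.id_comp]
          refine Limits.Pi.hom_ext _ _ fun A => ?_
          rw [Category.assoc, Limits.Pi.lift_π, lift_π, dif_neg]
          simp [mem_initial] }

/-- If two stages have the same product of sorts, then the later stages are retracts of them. -/
theorem nonempty_retract_initial {k l n : ℕ} (hkl : k < l) (hl : l ≤ N)
    (hdom : (initial C e k).dom = (initial C e l).dom) (hkn : k ≤ n) (hn : n ≤ N) :
    Nonempty (Retract (initial C e n).dom (initial C e k).dom) := by
  induction n, hkn using Nat.le_induction with
  | base => exact ⟨.refl _⟩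
  | succ n _ ih =>
    obtain ⟨r⟩ := ih (by omega)
    -- With `T` the product of all objects, `Tⁿ⁺¹ ≅ Tⁿ ⨯ T` is a retract of `Tᵏ ⨯ T ≅ Tᵏ⁺¹`, which
    -- is a retract of `Tˡ = Tᵏ`. The last retraction uses that stage `k + 1` has a constant of
    -- every sort, namely with the first label.
    obtain ⟨s, hs⟩ := exists_section_proj (initial_mono (C := C) e (Nat.succ_le_of_lt hkl))
      fun p _ => ⟨e.symm ⟨0, by omega⟩, by simp [mem_initial]⟩
    have r₁ : Retract ((initial C e n).dom ⨯ ∏ᶜ fun A : C => A)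
        ((initial C e k).dom ⨯ ∏ᶜ fun A : C => A) :=
      { i := prod.map r.i (𝟙 _), r := prod.map r.r (𝟙 _) }
    have r₂ : Retract (initial C e (k + 1)).dom (initial C e l).dom :=
      { i := s, r := proj _, retract := hs }
    exact ⟨(((Retract.ofIso (initialSuccIso e hn)).trans r₁).trans
      (Retract.ofIso (initialSuccIso e (hkl.trans_le hl)).symm)).trans
      (r₂.trans (Retract.ofIso (eqToIso hdom.symm)))⟩

end ConstList

/-! ### Finitely many labels: counting positions -/

/-- The total number of elements exceeds that of a given fiber by two for each other object. -/
theorem Doctrine.card_fib_add_le {P : Doctrine.{u, v, w} C} (hP : P.HasNontrivialFibers)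
    [Finite (Σ A : C, P.Fib A)] (A : C) :
    Nat.card (P.Fib A) + 2 * Nat.card C ≤ Nat.card (Σ A : C, P.Fib A) + 2 := by
  classical
  have : ∀ A : C, Finite (P.Fib A) := fun A =>
    .of_injective (fun a => (⟨A, a⟩ : Σ A : C, P.Fib A)) fun a b h => eq_of_heq (Sigma.mk.inj h).2
  have : Finite C := .of_injective
    (fun A => (⟨A, (hP A).to_nonempty.some⟩ : Σ A : C, P.Fib A)) fun A B h => congrArg Sigma.fst h
  have := Fintype.ofFinite C
  rw [Nat.card_sigma, ← Finset.add_sum_erase _ _ (Finset.mem_univ A), Nat.card_eq_fintype_card (α := C)]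
  have h := Finset.card_nsmul_le_sum (Finset.univ.erase A) (fun A => Nat.card (P.Fib A)) 2
    fun B _ => Finite.one_lt_card_iff_nontrivial.2 (hP B)
  rw [Finset.card_erase_of_mem (Finset.mem_univ A), Finset.card_univ, smul_eq_mul] at h
  have : 0 < Fintype.card C := Fintype.card_pos_iff.2 ⟨A⟩
  omega

/-- Listings over finitely many labels. -/
theorem exists_listing_of_finite (P : Doctrine.{u, v, w} C) [PrimaryDoctrine P]
    (hP : P.HasNontrivialFibers) [Finite (Σ A : C, P.Fib A)] (B : C) :
    ∃ e : P.Labels → Σ X : ConstList C P.Labels, P.Fib (X.dom ⨯ B),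
      (∀ j, ∀ p ∈ (e j).1.1, p.2 < j) ∧ ∀ a, ∃ j, fibMk P (e j).1 (e j).2 = a := by
  classical
  have e₀ : P.Labels ≃ Σ A : C, P.Fib A := (Cardinal.eq.1 (Cardinal.mk_ord_toType _)).some
  have : Finite P.Labels := .of_equiv _ e₀.symm
  have hfin : ∀ A : C, Finite (P.Fib A) := fun A =>
    .of_injective (fun a => (⟨A, a⟩ : Σ A : C, P.Fib A)) fun a b h => eq_of_heq (Sigma.mk.inj h).2
  have : Finite C := .of_injective
    (fun A => (⟨A, (hP A).to_nonempty.some⟩ : Σ A : C, P.Fib A)) fun A B h => congrArg Sigma.fst h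
  have := Fintype.ofFinite C
  have := Fintype.ofFinite P.Labels
  have hB := Doctrine.card_fib_add_le hP B
  have h2 : 2 ≤ Nat.card (P.Fib B) := Finite.one_lt_card_iff_nontrivial.2 (hP B)
  have hC : 0 < Nat.card C := Finite.card_pos_iff.2 ⟨B⟩
  obtain ⟨N, hN⟩ : ∃ N, Nat.card (Σ A : C, P.Fib A) = N := ⟨_, rfl⟩
  let e : P.Labels ≃o Fin N := (Fintype.orderIsoFinOfCardEq P.Labels (by
    rw [← hN, ← Nat.card_eq_fintype_card, Nat.card_congr e₀])).symm
  -- two stages with the same product of sorts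
  obtain ⟨k, l, hk, hkl, hl, hdom⟩ : ∃ k l, 0 < k ∧ k < l ∧ l ≤ Nat.card C + 1 ∧
      (initial C e.toEquiv k).dom = (initial C e.toEquiv l).dom := by
    -- Pigeonhole on stages `1, …, |C| + 1`. Starting at `1` gives stage `k` constants of every sort
    -- and keeps position `0` free.
    obtain ⟨i, j, hij, h⟩ := Fintype.exists_ne_map_eq_of_card_lt
      (fun i : Fin (Nat.card C + 1) => (initial C e.toEquiv (i + 1)).dom) (by simp)
    rcases lt_or_gt_of_ne hij with hij | hij
    · exact ⟨i + 1, j + 1, by omega, by simpa using hij, by omega, h⟩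
    · exact ⟨j + 1, i + 1, by omega, by simpa using hij, by omega, h.symm⟩
  rw [hN] at hB
  have hkN : k < N := by omega
  obtain ⟨r⟩ := nonempty_retract_initial e.toEquiv hkl (by omega) hdom hkN.le le_rfl
  have hbij := bijective_re_projTimes P (initial_mono e.toEquiv hkN.le)
    (fun p _ => ⟨e.symm ⟨0, by omega⟩, by simpa [mem_initial] using hk⟩) r B
  have hrep : ∀ a : ConstFib P P.Labels B, ∃ φ, fibMk P (initial C e.toEquiv k) φ = a := by
    intro a
    induction a using fib_ind with
    | h X a =>
      -- Stage `N` contains all constants, so the colimit is attained there, and bijectivity brings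
      -- the representative down to stage `k`.
      have hX : X ≤ initial C e.toEquiv N := fun p _ => (mem_initial _).2 (Fin.is_lt _)
      obtain ⟨φ, hφ⟩ := hbij.2 (P.re (projTimes hX B) a)
      exact ⟨φ, by rw [← fibMk_re P hX, ← hφ, fibMk_re]⟩
  choose rep hrep using hrep
  have hinj : Function.Injective rep := Function.LeftInverse.injective hrep
  have : Finite (ConstFib P P.Labels B) := .of_injective _ hinj
  have := Fintype.ofFinite (ConstFib P P.Labels B)
  have hcard : Nat.card (ConstFib P P.Labels B) ≤ _ := Nat.card_le_card_of_injective _ hinj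
  have hle := Doctrine.card_fib_add_le hP ((initial C e.toEquiv k).dom ⨯ B)
  -- At most `N + 2 - 2|C|` elements exist; without `⊤` there remain at most `N + 1 - 2|C|`, which
  -- is at most `N - k` because `1 ≤ |C|` and `k ≤ |C|`.
  obtain ⟨g⟩ : Nonempty
      ({a : ConstFib P P.Labels B // a ≠ fibMk P nil (PrimaryDoctrine.top _)} ↪ Fin (N - k)) := by
    refine Function.Embedding.nonempty_of_card_le ?_
    rw [Fintype.card_fin, Fintype.card_subtype_compl, Fintype.card_subtype_eq,
      ← Nat.card_eq_fintype_card]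
    omega
  -- Representatives use labels below `k` and positions start at `k`, so position `0` is left for
  -- `⊤`.
  refine exists_listing_of_injective P B (fun a => ⟨initial C e.toEquiv k, rep a⟩) hrep
    (fun a => e.symm ⟨k + g a, by omega⟩) (fun a b h => ?_) (fun a p hp => ?_)
    (e.symm ⟨0, by omega⟩) fun a h => ?_
  · have := congrArg Fin.val (e.symm.injective h)
    exact g.injective (Fin.ext (by simpa using this))
  · rw [OrderIso.lt_symm_apply, Fin.lt_def]
    exact ((mem_initial _).1 hp).trans_le (Nat.le_add_right _ _)
  · have := congrArg Fin.val (e.symm.injective h)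
    simp at this
    omega

end FiniteExistence

/-! ### The proposition -/

theorem mainTheorem4 {C : Type u} [Category.{v} C] [HasFiniteProducts C]
    (P : Doctrine.{u, v, w} C) [BooleanDoctrine P] [ExistentialDoctrine P]
    (hP : P.HasNontrivialFibers) :
    Nonempty (HenkinListing P) ∧ ∀ H : HenkinListing P, H.richDoctrine.IsConsistent := by
  refine ⟨HenkinListing.nonempty_of_forall_lt P fun B => ?_, fun H =>
    addAxioms_isConsistent _ _ _ _ (H.not_inf_henkinAxiom_le_bot hP)⟩
  cases finite_or_infinite (Σ A : C, P.Fib A)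
  · exact exists_listing_of_finite P hP B
  · exact exists_listing_of_infinite P hP B
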